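/- Let $n\ge 1$. The polar $n$-complex numbers are the commutative real algebra $\mathbb R^n$ of elements $u=x_0+h_1x_1+\dots+h_{n-1}x_{n-1}$ ($h_0=1$) with $h_jh_k=h_l$, $l=(j+k)\bmod n$; the planar $n$-complex numbers, for $n$ even, are the same space with $h_jh_k=(-1)^{\lfloor (j+k)/n\rfloor}h_l$. Put $K=\lfloor (n-1)/2\rfloor$, $\theta_k=2\pi k/n$ in the polar case and $K=n/2$, $\theta_k=\pi(2k-1)/n$ in the planar case. For $1\le k\le K$ let $$\tilde e_k=\frac2n\sum_{p=0}^{n-1}h_p\sin(\theta_kp),\qquad \xi_k=\sqrt{\tfrac2n}\sum_{p=0}^{n-1}x_p\cos(\theta_kp),\qquad \eta_k=\sqrt{\tfrac2n}\sum_{p=0}^{n-1}x_p\sin(\theta_kp),$$ and write $u_{\xi_k\eta_k}$ for the projection $(\xi_k,\eta_k)$ of $u$ on the $k$-th plane. For a closed plane curve $C$ and a point $M\notin C$ let $\operatorname{int}(M,C)=1$ if $M$ is interior to $C$ (it lies in a bounded component of the complement of $C$) and $\operatorname{int}(M,C)=0$ if $M$ is exterior to $C$. In either case let $\Gamma$ be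 a piecewise $C^1$ closed loop, let $u_0$ be an $n$-complex number such that $u-u_0$ is invertible for every $u\in\Gamma$, and let $f$ be given by a power series, $f(u)=\sum_{l\ge0}a_l(u-c)^l$ with $n$-complex $a_l$ and $c$, converging at every point of an open set that contains $\Gamma$. Suppose that, whenever $u_{0\xi_k\eta_k}$ is interior to the projected loop $\Gamma_{\xi_k\eta_k}$ for some $k$, the series also converges to $f(u_0)$ at $u_0$, and this projected loop goes round $u_{0\xi_k\eta_k}$ exactly once in the positive sense (a continuous azimuthal angle about the point increases by $2\pi$ along it). Then $f(u)\,du/(u-u_0)$ is integrable along $\Gamma$ and $$\oint_\Gamma\frac{f(u)\,du}{u-u_0}=2\pi f(u_0)\sum_{k=1}^{K}\tilde e_k\,\operatorname{int}\bigl(u_{0\xi_k\eta_k},\Gamma_{\xi_k\eta_k}\bigr).$$ -/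

import Mathlib

open Set Filter Topology MeasureTheory
open scoped unitInterval

noncomputable section

/-! ### The algebras of `n`-complex numbers -/

/-- Real `n`-dimensional space with the modulus `|u|² = x₀² + ⋯ + xₙ₋₁²` as its norm. It carries the
multiplication of the bases `h_j h_k = s ^ ⌊(j + k) / n⌋ h_l`, `l = j + k - n ⌊(j + k) / n⌋`
(see `NComplex.mul_def`). -/
def NComplex (_s : ℝ) (n : ℕ) : Type := EuclideanSpace ℝ (Fin n)

/-- Polar `n`-complex numbers: `h_j h_k = h_l` with `l = (j + k) mod n`. -/
abbrev PolarComplex (n : ℕ) : Type := NComplex 1 n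

/-- Planar `n`-complex numbers: `h_j h_k = (-1) ^ ⌊(j + k) / n⌋ h_l` with `l = (j + k) mod n`. -/
abbrev PlanarComplex (n : ℕ) : Type := NComplex (-1) n

namespace NComplex

section Basic

variable {s : ℝ} {n : ℕ}

instance : NormedAddCommGroup (NComplex s n) :=
  inferInstanceAs (NormedAddCommGroup (EuclideanSpace ℝ (Fin n)))

instance : InnerProductSpace ℝ (NComplex s n) :=
  inferInstanceAs (InnerProductSpace ℝ (EuclideanSpace ℝ (Fin n)))

instance : FiniteDimensional ℝ (NComplex s n) :=
  inferInstanceAs (FiniteDimensional ℝ (EuclideanSpace ℝ (Fin n)))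

instance : CompleteSpace (NComplex s n) :=
  inferInstanceAs (CompleteSpace (EuclideanSpace ℝ (Fin n)))

/-- The number `x₀ + h₁ x₁ + ⋯ + hₙ₋₁ xₙ₋₁` with components `x₀, …, xₙ₋₁`. -/
def mk (x : Fin n → ℝ) : NComplex s n := WithLp.toLp 2 x

/-- The component `x_i` of an `n`-complex number. -/
def coord (u : NComplex s n) (i : Fin n) : ℝ := WithLp.ofLp (p := 2) (V := Fin n → ℝ) u i

@[simp] theorem coord_mk (x : Fin n → ℝ) (i : Fin n) : (mk x : NComplex s n).coord i = x i := rfl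

@[simp] theorem coord_add (u v : NComplex s n) (i : Fin n) :
    (u + v).coord i = u.coord i + v.coord i := rfl

@[simp] theorem coord_smul (r : ℝ) (u : NComplex s n) (i : Fin n) :
    (r • u).coord i = r * u.coord i := rfl

@[simp] theorem coord_sub (u v : NComplex s n) (i : Fin n) :
    (u - v).coord i = u.coord i - v.coord i := rfl

@[simp] theorem coord_zero (i : Fin n) : (0 : NComplex s n).coord i = 0 := rfl

@[ext] theorem ext {u v : NComplex s n} (h : ∀ i, u.coord i = v.coord i) : u = v :=
  PiLp.ext h

instance : One (NComplex s n) := ⟨mk fun i => if (i : ℕ) = 0 then 1 else 0⟩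

/-- `(∑ x_i h_i) (∑ y_j h_j) = ∑ x_i y_j h_i h_j`. -/
instance : Mul (NComplex s n) :=
  ⟨fun u v => mk fun k => ∑ i : Fin n, ∑ j : Fin n,
    if ((i : ℕ) + j) % n = k then s ^ (((i : ℕ) + j) / n) * (u.coord i * v.coord j) else 0⟩

theorem coord_one (i : Fin n) : (1 : NComplex s n).coord i = if (i : ℕ) = 0 then 1 else 0 := rfl

theorem mul_def (u v : NComplex s n) (k : Fin n) :
    (u * v).coord k = ∑ i : Fin n, ∑ j : Fin n,
      if ((i : ℕ) + j) % n = k then s ^ (((i : ℕ) + j) / n) * (u.coord i * v.coord j) else 0 := rfl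

end Basic

section Ring

variable {s : ℝ} {n : ℕ}

/-- Auxiliary: `∑ x_i h_i` as a polynomial in `h₁`, modulo `X ^ n - s`. -/
def toQuot (u : NComplex s n) : AdjoinRoot (Polynomial.X ^ n - Polynomial.C s) :=
  AdjoinRoot.mk _ (∑ i : Fin n, Polynomial.C (u.coord i) * Polynomial.X ^ (i : ℕ))

theorem toQuot_eq (u : NComplex s n) :
    toQuot u = ∑ i : Fin n, algebraMap ℝ _ (u.coord i) *
      AdjoinRoot.root (Polynomial.X ^ n - Polynomial.C s) ^ (i : ℕ) := by
  simp [toQuot, AdjoinRoot.algebraMap_eq]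

theorem toQuot_injective [NeZero n] : Function.Injective (toQuot (s := s) (n := n)) := by
  intro u v h
  have hn : 0 < n := Nat.pos_of_ne_zero (NeZero.ne n)
  have hd : (Polynomial.X ^ n - Polynomial.C s).degree = (n : WithBot ℕ) := Polynomial.degree_X_pow_sub_C hn s
  unfold toQuot at h
  rw [AdjoinRoot.mk_eq_mk, ← Finset.sum_sub_distrib] at h
  have h0 := Polynomial.eq_zero_of_dvd_of_degree_lt h (by
    rw [hd]
    refine lt_of_le_of_lt (Polynomial.degree_sum_le _ _) ?_
    refine (Finset.sup_lt_iff (WithBot.bot_lt_coe n)).2 fun i _ => ?_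
    rw [← sub_mul, ← Polynomial.C_sub]
    refine lt_of_le_of_lt (Polynomial.degree_C_mul_X_pow_le _ _) ?_
    exact WithBot.coe_lt_coe.2 i.2)
  ext i
  have := congrArg (fun p => Polynomial.coeff p (i : ℕ)) h0
  simp only [Polynomial.finsetSum_coeff, Polynomial.coeff_sub, Polynomial.coeff_C_mul,
    Polynomial.coeff_X_pow, Polynomial.coeff_zero, Fin.val_inj] at this
  simp at this
  linarith

theorem toQuot_add (u v : NComplex s n) : toQuot (u + v) = toQuot u + toQuot v := by
  simp [toQuot_eq, add_mul, Finset.sum_add_distrib]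

theorem toQuot_one [NeZero n] : toQuot (1 : NComplex s n) = 1 := by
  rw [toQuot_eq, Finset.sum_eq_single (0 : Fin n)]
  · simp [coord_one]
  · intro b _ hb
    have : (b : ℕ) ≠ 0 := fun h => hb (Fin.ext (by simpa using h))
    simp [coord_one, this]
  · simp

theorem toQuot_mul [NeZero n] (u v : NComplex s n) : toQuot (u * v) = toQuot u * toQuot v := by
  have hn : 0 < n := Nat.pos_of_ne_zero (NeZero.ne n)
  set r := AdjoinRoot.root (Polynomial.X ^ n - Polynomial.C s) with hr
  have hrn : r ^ n = algebraMap ℝ _ s := by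
    have := AdjoinRoot.eval₂_root (Polynomial.X ^ n - Polynomial.C s)
    simp only [Polynomial.eval₂_sub, Polynomial.eval₂_X_pow, Polynomial.eval₂_C] at this
    rw [AdjoinRoot.algebraMap_eq]
    exact sub_eq_zero.mp this
  have key : ∀ m : ℕ, r ^ m = algebraMap ℝ _ (s ^ (m / n)) * r ^ (m % n) := by
    intro m
    conv_lhs => rw [← Nat.div_add_mod m n, pow_add, pow_mul, hrn, ← map_pow]
  rw [toQuot_eq, toQuot_eq, toQuot_eq, Finset.sum_mul_sum, ← hr]
  simp only [mul_def, map_sum, Finset.sum_mul]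
  rw [Finset.sum_comm]
  refine Finset.sum_congr rfl fun i _ => ?_
  rw [Finset.sum_comm]
  refine Finset.sum_congr rfl fun j _ => ?_
  rw [Finset.sum_eq_single (⟨((i : ℕ) + j) % n, Nat.mod_lt _ hn⟩ : Fin n)]
  · simp only [if_true, map_mul]
    have h2 : r ^ (i : ℕ) * r ^ (j : ℕ) =
        algebraMap ℝ _ (s ^ (((i : ℕ) + j) / n)) * r ^ (((i : ℕ) + j) % n) := by
      rw [← pow_add, key]
    linear_combination (-(algebraMap ℝ _ (u.coord i)) * (algebraMap ℝ _ (v.coord j))) * h2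
  · intro b _ hb
    have : ¬ ((i : ℕ) + j) % n = b := fun h => hb (Fin.ext h.symm)
    simp [this]
  · simp

instance [NeZero n] : CommRing (NComplex s n) where
  __ := (inferInstance : AddCommGroup (NComplex s n))
  mul_assoc a b c := toQuot_injective (by simp only [toQuot_mul, mul_assoc])
  mul_comm a b := toQuot_injective (by simp only [toQuot_mul, mul_comm])
  one_mul a := toQuot_injective (by simp only [toQuot_mul, toQuot_one, one_mul])
  mul_one a := toQuot_injective (by simp only [toQuot_mul, toQuot_one, mul_one])
  left_distrib a b c := toQuot_injective (by simp only [toQuot_mul, toQuot_add, mul_add])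
  right_distrib a b c := toQuot_injective (by simp only [toQuot_mul, toQuot_add, add_mul])
  zero_mul a := by ext i; simp [mul_def]
  mul_zero a := by ext i; simp [mul_def]

instance [NeZero n] : Algebra ℝ (NComplex s n) :=
  Algebra.ofModule
    (fun r x y => by
      ext k
      simp only [mul_def, coord_smul, Finset.mul_sum]
      refine Finset.sum_congr rfl fun i _ => Finset.sum_congr rfl fun j _ => ?_
      split_ifs <;> ring)
    (fun r x y => by
      ext k
      simp only [mul_def, coord_smul, Finset.mul_sum]
      refine Finset.sum_congr rfl fun i _ => Finset.sum_congr rfl fun j _ => ?_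
      split_ifs <;> ring)

end Ring

/-! ### The planes `ξ_k, η_k` and the hypercomplex bases `ẽ_k`

Both kinds of numbers are treated at once: `θ` is the angle `2πk/n` for polar and `π(2k-1)/n` for
planar numbers. -/

section Planes

variable {s : ℝ} {n : ℕ}

/-- `v = ∑ x_p cos (θ p)`. -/
def cosComp (θ : ℝ) (u : NComplex s n) : ℝ := ∑ p : Fin n, u.coord p * Real.cos (θ * (p : ℕ))

/-- `ṽ = ∑ x_p sin (θ p)`. -/
def sinComp (θ : ℝ) (u : NComplex s n) : ℝ := ∑ p : Fin n, u.coord p * Real.sin (θ * (p : ℕ))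

/-- The projection onto the plane of the axes `ξ, η`, where `v = √(n/2) ξ` and `ṽ = √(n/2) η`; the
point of coordinates `(ξ, η)` is written as the ordinary complex number `ξ + i η`. -/
def planeProj (θ : ℝ) (u : NComplex s n) : ℂ :=
  ⟨cosComp θ u / Real.sqrt (n / 2), sinComp θ u / Real.sqrt (n / 2)⟩

/-- `ẽ = (2/n) ∑ h_p sin (θ p)`. -/
def eTilde (θ : ℝ) : NComplex s n := mk fun p => 2 / n * Real.sin (θ * (p : ℕ))

end Planes

/-- `2πk/n`. -/
def polarAngle (n k : ℕ) : ℝ := 2 * Real.pi * k / n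

/-- `π(2k-1)/n`. -/
def planarAngle (n k : ℕ) : ℝ := Real.pi * (2 * k - 1) / n

/-! ### Power series and path integrals -/

section Integrals

variable {s : ℝ} {n : ℕ}

/-- The power series `∑ a_l (u - c)^l` converges at `u`, with sum `f u`. -/
def ExpandsAt [NeZero n] (f : NComplex s n → NComplex s n) (a : ℕ → NComplex s n)
    (c u : NComplex s n) : Prop :=
  Tendsto (fun N : ℕ => ∑ l ∈ Finset.range N, a l * (u - c) ^ l) atTop (𝓝 (f u))

/-- The differential form `f(u) du / (u - u₀)`, that is the map `w ↦ f(u) (u - u₀)⁻¹ w` at `u`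
(`Ring.inverse` is the inverse on invertible elements, and zero elsewhere). -/
def residueForm [NeZero n] (f : NComplex s n → NComplex s n) (u₀ u : NComplex s n) :
    NComplex s n →L[ℝ] NComplex s n :=
  (LinearMap.mulLeft ℝ (f u * Ring.inverse (u - u₀))).toContinuousLinearMap

end Integrals

end NComplex

/-- A path is piecewise continuously differentiable: it is `C¹` on each closed interval of a
subdivision `0 = τ₀ ≤ τ₁ ≤ ⋯ ≤ τ_m = 1`. -/
def PiecewiseC1 {E : Type*} [NormedAddCommGroup E] [NormedSpace ℝ E] {a b : E}
    (γ : Path a b) : Prop :=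
  ∃ (m : ℕ) (τ : ℕ → ℝ), Monotone τ ∧ τ 0 = 0 ∧ τ m = 1 ∧
    ∀ i < m, ContDiffOn ℝ 1 γ.extend (Icc (τ i) (τ (i + 1)))

/-! ### The functional `int(M, C)` -/

/-- `M` is an interior point of the closed curve with trace `C`: it lies off `C`, in a bounded
connected component of the complement of `C`. -/
def IsInteriorPoint (M : ℂ) (C : Set ℂ) : Prop :=
  M ∉ C ∧ Bornology.IsBounded (connectedComponentIn Cᶜ M)

open Classical in
/-- `int(M, C)`: `1` if `M` is interior to `C`, `0` if it is exterior to `C`. -/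
def curveInt (M : ℂ) (C : Set ℂ) : ℝ := if IsInteriorPoint M C then 1 else 0

/-- The closed plane curve `g` goes round `M` exactly once in the positive (counterclockwise) sense:
it avoids `M`, and a continuous choice of its azimuthal angle about `M` increases by `2π`. -/
def WindsOnce (g : I → ℂ) (M : ℂ) : Prop :=
  ∃ φ : I → ℝ, Continuous φ ∧ (∀ t, g t ≠ M) ∧
    (∀ t, g t - M = ‖g t - M‖ * Complex.exp (φ t * Complex.I)) ∧ φ 1 = φ 0 + 2 * Real.pi

end

/-!
The residue formula is reduced to the complex plane by characters. Each root `ω` of `X ^ n - s` gives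
the ring homomorphism `∑ x_p h_p ↦ ∑ x_p ω ^ p` to `ℂ` (`NComplex.character`), and since the `n` roots
are distinct these homomorphisms separate points; by conjugation the roots with `0 ≤ Im ω` suffice
(`NComplex.ext_character`). For `ω = exp (i θ_k)` the character is, up to the factor `√(n/2)`, the
projection on the `k`-th plane. It carries `f(u) du / (u - u₀)` to `F(z) dz / (z - z₀)` along the
projected loop, where `F` is the sum of the projected power series.

Characters are open onto their image, so convergence of the series near the loop puts the whole projected
loop in an open disc on which `F` is holomorphic. An interior point `z₀` lies in this disc, and the
holomorphic function `(F(z) - F(z₀)) / (z - z₀)` has a primitive there, which leaves `F(z₀) ∮ dz / (z - z₀)`.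
This is `2πi F(z₀)` when an azimuthal angle increases by `2π`
(`HasVelocity.integral_inv_sub_of_angle`). For an exterior `z₀` the winding integral is zero, since it is
locally constant in `z₀` and zero far away
(`HasVelocity.integral_inv_sub_eq_zero_of_not_isInteriorPoint`); when `z₀` is moreover outside the disc,
`F(z) / (z - z₀)` itself has a primitive. In all cases the result is `2πi int(z₀, Γ_k) F(z₀)`
(`HasVelocity.residue_formula`).

By orthogonality the character at `exp (i θ_j)` maps `ẽ_k` to `i δ_{jk}` (`NComplex.character_eTilde`), so
both sides of the formula agree under it. At a real root the projected loop runs in a line, encloses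
nothing, and every `ẽ_k` maps to zero, so both sides vanish.
-/

noncomputable section

/-! ### Integrals along plane curves -/

/-- `z : [0, 1] → ℂ` is a continuous plane curve with integrable velocity `v`, which is its derivative off
a countable set of parameters. -/
structure HasVelocity (z v : ℝ → ℂ) : Prop where
  continuousOn : ContinuousOn z (Icc 0 1)
  intervalIntegrable : IntervalIntegrable v volume 0 1
  hasDerivAt : ∃ S : Set ℝ, S.Countable ∧ ∀ t ∈ Ioo (0 : ℝ) 1 \ S, HasDerivAt z (v t) t

namespace HasVelocity

variable {z v : ℝ → ℂ}

theorem intervalIntegrable_comp_mul (h : HasVelocity z v) {G : ℂ → ℂ}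
    (hG : ContinuousOn G (z '' Icc 0 1)) :
    IntervalIntegrable (fun t => G (z t) * v t) volume 0 1 := by
  refine h.intervalIntegrable.continuousOn_mul ?_
  rw [uIcc_of_le zero_le_one]
  exact hG.comp h.continuousOn (mapsTo_image _ _)

/-- The fundamental theorem of calculus for `∫ G(z) dz` along the curve, for a primitive `L` of the
integrand that need only be given along the curve. -/
theorem integral_comp_mul_eq_sub_of_hasDerivAt (h : HasVelocity z v) {G : ℂ → ℂ} {L : ℝ → ℂ}
    (hG : ContinuousOn G (z '' Icc 0 1)) (hL : ContinuousOn L (Icc 0 1))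
    (hd : ∀ t ∈ Ioo (0 : ℝ) 1, HasDerivAt z (v t) t → HasDerivAt L (G (z t) * v t) t) :
    ∫ t in (0 : ℝ)..1, G (z t) * v t = L 1 - L 0 := by
  obtain ⟨S, hS, hz⟩ := h.hasDerivAt
  exact integral_eq_of_hasDerivAt_off_countable_of_le _ _ zero_le_one hS hL
    (fun t ht => hd t ht.1 (hz t ht)) (h.intervalIntegrable_comp_mul hG)

theorem integral_comp_mul_eq_sub (h : HasVelocity z v) {G g : ℂ → ℂ}
    (hG : ContinuousOn G (z '' Icc 0 1)) (hg : ∀ w ∈ z '' Icc 0 1, HasDerivAt g (G w) w) :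
    ∫ t in (0 : ℝ)..1, G (z t) * v t = g (z 1) - g (z 0) := by
  refine h.integral_comp_mul_eq_sub_of_hasDerivAt (L := g ∘ z) hG ?_ fun t ht hz => ?_
  · exact ContinuousOn.comp (fun w hw => (hg w hw).continuousAt.continuousWithinAt)
      h.continuousOn (mapsTo_image _ _)
  · exact (hg _ (mem_image_of_mem _ (Ioo_subset_Icc_self ht))).comp t hz

theorem continuousOn_inv_sub {M : ℂ} {C : Set ℂ} (hM : M ∉ C) :
    ContinuousOn (fun w => (w - M)⁻¹) C :=
  ContinuousOn.inv₀ (by fun_prop) fun w hw h0 => hM (sub_eq_zero.1 h0 ▸ hw)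

/-! ### The winding integral `∮ dz / (z - M)` -/

/-- A continuous azimuthal angle `φ` gives the continuous logarithm `log |z - M| + i φ` of `z - M`, which
is a primitive of `dz / (z - M)` along the curve. -/
theorem integral_inv_sub_of_angle (h : HasVelocity z v) (hz : z 0 = z 1) {M : ℂ} {φ : ℝ → ℝ}
    (hM : M ∉ z '' Icc 0 1) (hφ : ContinuousOn φ (Icc 0 1))
    (hangle : ∀ t ∈ Icc (0 : ℝ) 1, z t - M = ‖z t - M‖ * Complex.exp (φ t * Complex.I))
    (hφ1 : φ 1 = φ 0 + 2 * Real.pi) :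
    ∫ t in (0 : ℝ)..1, (z t - M)⁻¹ * v t = 2 * Real.pi * Complex.I := by
  have hne : ∀ t ∈ Icc (0 : ℝ) 1, z t - M ≠ 0 := fun t ht h0 =>
    hM ⟨t, ht, sub_eq_zero.1 h0⟩
  set L : ℝ → ℂ := fun t => (Real.log ‖z t - M‖ : ℂ) + φ t * Complex.I with hLdef
  have hexp : ∀ t ∈ Icc (0 : ℝ) 1, Complex.exp (L t) = z t - M := by
    intro t ht
    rw [hLdef, Complex.exp_add, ← Complex.ofReal_exp,
      Real.exp_log (norm_pos_iff.2 (hne t ht)), ← hangle t ht]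
  have hLc : ContinuousOn L (Icc 0 1) := by
    refine ContinuousOn.add ?_ ?_
    · refine Complex.continuous_ofReal.comp_continuousOn ?_
      exact ContinuousOn.log (h.continuousOn.sub continuousOn_const).norm
        fun t ht => norm_ne_zero_iff.2 (hne t ht)
    · exact (Complex.continuous_ofReal.comp_continuousOn hφ).mul continuousOn_const
  rw [h.integral_comp_mul_eq_sub_of_hasDerivAt (L := L) (G := fun w => (w - M)⁻¹)
    (continuousOn_inv_sub hM) hLc]
  · simp only [hLdef, hφ1, ← hz]
    push_cast
    ring
  · intro t ht hzt
    have htI := Ioo_subset_Icc_self ht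
    have hnhds : Icc (0 : ℝ) 1 ∈ 𝓝 t := Icc_mem_nhds ht.1 ht.2
    -- near `t` the logarithm `L` differs from `L t` by the principal logarithm of the quotient
    have hev : (fun s => L t + Complex.log ((z s - M) / (z t - M))) =ᶠ[𝓝 t] L := by
      have hc : Tendsto (fun s => (L s - L t).im) (𝓝 t) (𝓝 0) := by
        have h1 : ContinuousAt (fun s => (L s - L t).im) t :=
          Complex.continuous_im.continuousAt.comp
            ((hLc.continuousAt hnhds).sub continuousAt_const)
        simpa [ContinuousAt] using h1
      filter_upwards [hnhds, hc (Ioo_mem_nhds (neg_lt_zero.2 Real.pi_pos) Real.pi_pos)]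
        with s hs him
      rw [← hexp s hs, ← hexp t htI, ← Complex.exp_sub, Complex.log_exp him.1 him.2.le]
      ring
    have hd : HasDerivAt (fun s => (z s - M) / (z t - M)) (v t / (z t - M)) t :=
      (hzt.sub_const M).div_const _
    have hlog := hd.clog_real (by
      rw [div_self (hne t htI)]
      exact Complex.one_mem_slitPlane)
    rw [div_self (hne t htI), div_one] at hlog
    have := (hlog.const_add (L t)).congr_of_eventuallyEq hev.symm
    rwa [div_eq_inv_mul] at this

theorem isCompact_image (h : HasVelocity z v) : IsCompact (z '' Icc 0 1) :=
  isCompact_Icc.image_of_continuousOn h.continuousOn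

/-- The winding integral does not change when `M` moves by less than its distance to the curve: the
principal logarithm of `(z - M') / (z - M)` is a primitive of the difference. -/
theorem integral_inv_sub_eq_of_dist_lt (h : HasVelocity z v) (hz : z 0 = z 1) {M M' : ℂ}
    (hM : M ∉ z '' Icc 0 1) (hd : ∀ w ∈ z '' Icc 0 1, dist M' M < dist w M) :
    ∫ t in (0 : ℝ)..1, (z t - M')⁻¹ * v t = ∫ t in (0 : ℝ)..1, (z t - M)⁻¹ * v t := by
  have hM' : M' ∉ z '' Icc 0 1 := fun hm => (hd _ hm).false
  have h1 := h.intervalIntegrable_comp_mul (continuousOn_inv_sub hM)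
  have h2 := h.intervalIntegrable_comp_mul (continuousOn_inv_sub hM')
  rw [← sub_eq_zero, ← intervalIntegral.integral_sub h2 h1]
  simp only [← sub_mul]
  rw [h.integral_comp_mul_eq_sub (G := fun w => (w - M')⁻¹ - (w - M)⁻¹)
    (g := fun w => Complex.log ((w - M') / (w - M)))
    ((continuousOn_inv_sub hM').sub (continuousOn_inv_sub hM)), hz, sub_self]
  intro w hw
  have hw0 : w - M ≠ 0 := fun h0 => hM (sub_eq_zero.1 h0 ▸ hw)
  have hw0' : w - M' ≠ 0 := fun h0 => hM' (sub_eq_zero.1 h0 ▸ hw)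
  have hslit : (w - M') / (w - M) ∈ Complex.slitPlane := by
    refine Complex.ball_one_subset_slitPlane ?_
    rw [Metric.mem_ball, dist_eq_norm]
    have : (w - M') / (w - M) - 1 = -((M' - M) / (w - M)) := by field_simp; ring
    rw [this, norm_neg, norm_div, div_lt_one (norm_pos_iff.2 hw0)]
    simpa [dist_eq_norm] using hd w hw
  convert! (((hasDerivAt_id' w).sub_const M').fun_div ((hasDerivAt_id' w).sub_const M) hw0).clog
    hslit using 1
  field_simp

theorem integral_inv_sub_eq_zero_of_norm_lt (h : HasVelocity z v) (hz : z 0 = z 1) {M : ℂ}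
    (hd : ∀ w ∈ z '' Icc 0 1, ‖w‖ < ‖M‖) :
    ∫ t in (0 : ℝ)..1, (z t - M)⁻¹ * v t = 0 := by
  have hM : M ∉ z '' Icc 0 1 := fun hm => (hd _ hm).false
  have hM0 : M ≠ 0 := by
    rintro rfl
    have := hd _ (mem_image_of_mem _ (left_mem_Icc.2 zero_le_one))
    simp at this
    exact absurd this (norm_nonneg _).not_gt
  rw [h.integral_comp_mul_eq_sub (G := fun w => (w - M)⁻¹)
    (g := fun w => Complex.log (1 - w / M)) (continuousOn_inv_sub hM), hz, sub_self]
  intro w hw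
  have hw0 : w - M ≠ 0 := fun h0 => hM (sub_eq_zero.1 h0 ▸ hw)
  have hslit : 1 - w / M ∈ Complex.slitPlane := by
    refine Complex.ball_one_subset_slitPlane ?_
    rw [Metric.mem_ball, dist_eq_norm]
    have : 1 - w / M - 1 = -(w / M) := by ring
    rw [this, norm_neg, norm_div, div_lt_one (norm_pos_iff.2 hM0)]
    exact hd w hw
  convert! (((hasDerivAt_id' w).div_const M).const_sub 1).clog hslit using 1
  have hw1 : M - w ≠ 0 := fun h0 => hw0 (by rw [← neg_sub, h0, neg_zero])
  field_simp
  ring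

/-- The winding integral is locally constant in `M` off the curve and vanishes far away, hence it vanishes
on every unbounded component of the complement. -/
theorem integral_inv_sub_eq_zero_of_not_isInteriorPoint (h : HasVelocity z v) (hz : z 0 = z 1)
    {M : ℂ} (hM : M ∉ z '' Icc 0 1) (hext : ¬ IsInteriorPoint M (z '' Icc 0 1)) :
    ∫ t in (0 : ℝ)..1, (z t - M)⁻¹ * v t = 0 := by
  set C := z '' Icc 0 1 with hC
  have hub : ¬ Bornology.IsBounded (connectedComponentIn Cᶜ M) := fun hb => hext ⟨hM, hb⟩
  obtain ⟨r, hr⟩ := h.isCompact_image.isBounded.subset_ball 0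
  obtain ⟨M₁, hM₁, hr₁⟩ : ∃ M₁ ∈ connectedComponentIn Cᶜ M, r ≤ ‖M₁‖ := by
    by_contra! hcon
    exact hub (Metric.isBounded_ball.subset fun w hw => mem_ball_zero_iff.2 (hcon w hw))
  have hpre : PreconnectedSpace (connectedComponentIn Cᶜ M) :=
    isPreconnected_iff_preconnectedSpace.1 isPreconnected_connectedComponentIn
  have hlc : IsLocallyConstant fun w : connectedComponentIn Cᶜ M =>
      ∫ t in (0 : ℝ)..1, (z t - w)⁻¹ * v t := by
    rw [IsLocallyConstant.iff_eventually_eq]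
    rintro ⟨w, hw⟩
    have hwC : w ∉ C := connectedComponentIn_subset _ _ hw
    obtain ⟨ε, hε, hb⟩ := Metric.isOpen_iff.1 h.isCompact_image.isClosed.isOpen_compl w hwC
    filter_upwards [Metric.ball_mem_nhds _ hε] with w' hw'
    refine h.integral_inv_sub_eq_of_dist_lt hz hwC fun y hy => lt_of_lt_of_le hw' ?_
    by_contra! hlt
    exact hb hlt hy
  have := hlc.apply_eq_of_preconnectedSpace ⟨M, mem_connectedComponentIn hM⟩ ⟨M₁, hM₁⟩
  refine this.trans (h.integral_inv_sub_eq_zero_of_norm_lt hz fun w hw => ?_)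
  exact (mem_ball_zero_iff.1 (hr hw)).trans_le hr₁

end HasVelocity

/-! ### Interior points of plane sets -/

theorem not_isBounded_ray {M d : ℂ} (hd : d ≠ 0) :
    ¬ Bornology.IsBounded ((fun r : ℝ => M + r * d) '' Ici 0) := by
  intro hb
  obtain ⟨r, hr⟩ := hb.subset_ball M
  have := hr (mem_image_of_mem _ (show |r| / ‖d‖ ∈ Ici 0 from by
    simp only [mem_Ici]; positivity))
  rw [Metric.mem_ball, dist_eq_norm] at this
  have hd' := norm_ne_zero_iff.2 hd
  simp only [add_sub_cancel_left, norm_mul, Complex.norm_real, norm_div, Real.norm_eq_abs,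
    abs_abs, abs_norm, div_mul_cancel₀ _ hd'] at this
  exact (le_abs_self r).not_gt this

/-- A point from which some ray avoids `C` is not interior to `C`. -/
theorem not_isInteriorPoint_of_ray {M d : ℂ} {C : Set ℂ} (hd : d ≠ 0)
    (hray : ∀ r : ℝ, 0 ≤ r → M + r * d ∉ C) : ¬ IsInteriorPoint M C := by
  rintro ⟨-, hb⟩
  refine not_isBounded_ray (M := M) hd (hb.subset ?_)
  refine IsPreconnected.subset_connectedComponentIn ?_ ⟨0, by simp, by simp⟩ ?_
  · exact (convex_Ici (0 : ℝ)).isPreconnected.image _ (by fun_prop)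
  · rintro _ ⟨r, hr, rfl⟩
    exact hray r hr

theorem IsInteriorPoint.mem_ball {M c : ℂ} {C : Set ℂ} {R : ℝ} (hR : 0 < R)
    (h : IsInteriorPoint M C) (hC : C ⊆ Metric.ball c R) : M ∈ Metric.ball c R := by
  by_contra hM
  rw [Metric.mem_ball, dist_eq_norm, not_lt] at hM
  refine not_isInteriorPoint_of_ray (d := M - c) (norm_pos_iff.1 (hR.trans_le hM))
    (fun r hr hmem => ?_) h
  have := hC hmem
  rw [Metric.mem_ball, dist_eq_norm,
    show M + r * (M - c) - c = ((1 + r : ℝ) : ℂ) * (M - c) by push_cast; ring, norm_mul,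
    Complex.norm_real, Real.norm_of_nonneg (by linarith)] at this
  nlinarith [norm_nonneg (M - c)]

theorem not_isInteriorPoint_of_im_eq_zero {M : ℂ} {C : Set ℂ} (hMC : M ∉ C) (hM : M.im = 0)
    (hC : ∀ w ∈ C, w.im = 0) : ¬ IsInteriorPoint M C := by
  refine not_isInteriorPoint_of_ray Complex.I_ne_zero fun r _ hmem => ?_
  have := hC _ hmem
  simp [hM] at this
  exact hMC (by simpa [this] using hmem)

/-! ### The residue formula in the plane -/

/-- A complex power series that converges at `w` is holomorphic on the disc about its centre whose
boundary passes through `w`. -/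
theorem exists_differentiableOn_ball_of_tendsto {b : ℕ → ℂ} {c w y : ℂ}
    (h : Tendsto (fun N : ℕ => ∑ l ∈ Finset.range N, b l * (w - c) ^ l) atTop (𝓝 y)) :
    ∃ F : ℂ → ℂ, DifferentiableOn ℂ F (Metric.ball c ‖w - c‖) ∧
      ∀ x ∈ Metric.ball c ‖w - c‖,
        Tendsto (fun N : ℕ => ∑ l ∈ Finset.range N, b l * (x - c) ^ l) atTop (𝓝 (F x)) := by
  have hterm : Tendsto (fun N => b N * (w - c) ^ N) atTop (𝓝 0) := by
    have := ((tendsto_add_atTop_iff_nat 1).2 h).sub h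
    simpa [Finset.sum_range_succ] using this
  set p := FormalMultilinearSeries.ofScalars ℂ b with hp
  have hrad : (‖w - c‖₊ : ENNReal) ≤ p.radius := by
    refine p.le_radius_of_tendsto (l := 0) ?_
    have := hterm.norm
    simp only [norm_zero, norm_mul, norm_pow] at this
    simpa [hp, FormalMultilinearSeries.ofScalars_norm] using this
  rcases eq_or_ne w c with rfl | hwc
  · exact ⟨0, by simp, by simp⟩
  have hpos : 0 < p.radius := lt_of_lt_of_le (by simpa [sub_eq_zero] using hwc) hrad
  have hball := p.hasFPowerSeriesOnBall hpos
  have hmem : ∀ x ∈ Metric.ball c ‖w - c‖, x - c ∈ Metric.eball (0 : ℂ) p.radius := by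
    intro x hx
    rw [Metric.mem_eball, edist_zero_right]
    refine lt_of_lt_of_le ?_ hrad
    rw [Metric.mem_ball, dist_eq_norm] at hx
    exact_mod_cast hx
  refine ⟨fun x => p.sum (x - c), ?_, fun x hx => ?_⟩
  · exact hball.differentiableOn.comp (by fun_prop) hmem
  · have := (hball.hasSum (hmem x hx)).tendsto_sum_nat
    simpa [hp, FormalMultilinearSeries.ofScalars_apply_eq, mul_comm] using this

open Classical in
/-- The residue formula for a function that is holomorphic on a disc containing the curve. When `M` lies
outside the disc the integrand itself has a primitive there. -/
theorem HasVelocity.integral_mul_inv_sub {z v : ℝ → ℂ} (h : HasVelocity z v) (hz : z 0 = z 1)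
    {M c : ℂ} {R : ℝ} {F : ℂ → ℂ} (hM : M ∉ z '' Icc 0 1) (hF : DifferentiableOn ℂ F (Metric.ball c R))
    (hsub : z '' Icc 0 1 ⊆ Metric.ball c R) :
    ∫ t in (0 : ℝ)..1, F (z t) * (z t - M)⁻¹ * v t =
      (if M ∈ Metric.ball c R then F M else 0) * ∫ t in (0 : ℝ)..1, (z t - M)⁻¹ * v t := by
  -- a function holomorphic on the disc integrates to zero along the curve
  have key : ∀ G : ℂ → ℂ, DifferentiableOn ℂ G (Metric.ball c R) →
      ∫ t in (0 : ℝ)..1, G (z t) * v t = 0 := by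
    intro G hG
    obtain ⟨g, hg⟩ := hG.isExactOn_ball
    rw [h.integral_comp_mul_eq_sub (hG.continuousOn.mono hsub) fun w hw => hg w (hsub hw), hz,
      sub_self]
  split_ifs with hMb
  · have hds := key _ ((Complex.differentiableOn_dslope (Metric.isOpen_ball.mem_nhds hMb)).2 hF)
    have h1 := h.intervalIntegrable_comp_mul (G := fun w => F w * (w - M)⁻¹)
      ((hF.continuousOn.mono hsub).mul (continuousOn_inv_sub hM))
    have h2 := (h.intervalIntegrable_comp_mul (continuousOn_inv_sub hM)).const_mul (F M)
    rw [← intervalIntegral.integral_const_mul, ← sub_eq_zero,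
      ← intervalIntegral.integral_sub h1 h2, ← hds]
    refine intervalIntegral.integral_congr fun t ht => ?_
    rw [uIcc_of_le zero_le_one] at ht
    have hne : z t ≠ M := fun h0 => hM ⟨t, ht, h0⟩
    simp only [dslope_of_ne _ hne, slope_def_field]
    ring
  · rw [zero_mul]
    refine key (fun w => F w * (w - M)⁻¹) (hF.mul (DifferentiableOn.inv (by fun_prop) ?_))
    exact fun w hw h0 => hMb (sub_eq_zero.1 h0 ▸ hw)

/-- The residue formula in the plane, for a function given by a power series along a closed curve. -/
theorem HasVelocity.residue_formula {z v Φ : ℝ → ℂ} (h : HasVelocity z v) (hz : z 0 = z 1)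
    {M c y : ℂ} {b : ℕ → ℂ} (hM : M ∉ z '' Icc 0 1)
    (hΦ : ∀ t ∈ Icc (0 : ℝ) 1,
      Tendsto (fun N : ℕ => ∑ l ∈ Finset.range N, b l * (z t - c) ^ l) atTop (𝓝 (Φ t)))
    (hfar : ∀ t ∈ Icc (0 : ℝ) 1, ∃ w q, ‖z t - c‖ < ‖w - c‖ ∧
      Tendsto (fun N : ℕ => ∑ l ∈ Finset.range N, b l * (w - c) ^ l) atTop (𝓝 q))
    (hint : IsInteriorPoint M (z '' Icc 0 1) →
      Tendsto (fun N : ℕ => ∑ l ∈ Finset.range N, b l * (M - c) ^ l) atTop (𝓝 y) ∧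
      ∃ φ : ℝ → ℝ, ContinuousOn φ (Icc 0 1) ∧
        (∀ t ∈ Icc (0 : ℝ) 1, z t - M = ‖z t - M‖ * Complex.exp (φ t * Complex.I)) ∧
        φ 1 = φ 0 + 2 * Real.pi) :
    IntervalIntegrable (fun t => Φ t * (z t - M)⁻¹ * v t) volume 0 1 ∧
    ∫ t in (0 : ℝ)..1, Φ t * (z t - M)⁻¹ * v t =
      2 * Real.pi * Complex.I * curveInt M (z '' Icc 0 1) * y := by
  -- a disc on which the series converges and which contains the whole curve
  obtain ⟨t₀, ht₀, hmax⟩ := isCompact_Icc.exists_isMaxOn (nonempty_Icc.2 (zero_le_one (α := ℝ)))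
    (h.continuousOn.sub (continuousOn_const (c := c))).norm
  obtain ⟨w, q, hw, hq⟩ := hfar t₀ ht₀
  obtain ⟨F, hF, hFs⟩ := exists_differentiableOn_ball_of_tendsto hq
  have hsub : z '' Icc 0 1 ⊆ Metric.ball c ‖w - c‖ := by
    rintro _ ⟨t, ht, rfl⟩
    rw [Metric.mem_ball, dist_eq_norm]
    exact lt_of_le_of_lt (hmax ht) hw
  have hΦF : ∀ t ∈ Icc (0 : ℝ) 1, Φ t = F (z t) := fun t ht =>
    tendsto_nhds_unique (hΦ t ht) (hFs _ (hsub (mem_image_of_mem _ ht)))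
  have hcongr : ∀ t ∈ Icc (0 : ℝ) 1,
      Φ t * (z t - M)⁻¹ * v t = F (z t) * (z t - M)⁻¹ * v t := fun t ht => by rw [hΦF t ht]
  have hii := h.intervalIntegrable_comp_mul (G := fun w => F w * (w - M)⁻¹)
    ((hF.continuousOn.mono hsub).mul (continuousOn_inv_sub hM))
  constructor
  · refine hii.congr fun t ht => ?_
    rw [uIoc_of_le zero_le_one] at ht
    exact (hcongr t (Ioc_subset_Icc_self ht)).symm
  rw [intervalIntegral.integral_congr (g := fun t => F (z t) * (z t - M)⁻¹ * v t)
    (fun t ht => hcongr t (by rwa [uIcc_of_le zero_le_one] at ht)),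
    h.integral_mul_inv_sub hz hM hF hsub]
  by_cases hi : IsInteriorPoint M (z '' Icc 0 1)
  · obtain ⟨hy, φ, hφ, hangle, hφ1⟩ := hint hi
    have hMb := hi.mem_ball (lt_of_le_of_lt (norm_nonneg _) hw) hsub
    rw [if_pos hMb, h.integral_inv_sub_of_angle hz hM hφ hangle hφ1,
      tendsto_nhds_unique hy (hFs M hMb), curveInt, if_pos hi]
    push_cast
    ring
  · rw [h.integral_inv_sub_eq_zero_of_not_isInteriorPoint hz hM hi, curveInt, if_neg hi]
    simp

namespace NComplex

/-! ### The complex characters -/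

section Character

variable {s : ℝ} {n : ℕ} [NeZero n]

/-- The character `∑ x_p h_p ↦ ∑ x_p ω ^ p` attached to a root `ω` of `X ^ n - s`. -/
def character (ω : ℂ) (hω : ω ^ n = s) : NComplex s n →ₐ[ℝ] ℂ :=
  have key : ∀ u : NComplex s n, ∑ p : Fin n, (u.coord p : ℂ) * ω ^ (p : ℕ) =
      AdjoinRoot.lift (algebraMap ℝ ℂ) ω (by simp [hω]) (toQuot u) := by
    intro u
    simp [toQuot]
  AlgHom.ofLinearMap
    { toFun := fun u => ∑ p : Fin n, (u.coord p : ℂ) * ω ^ (p : ℕ)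
      map_add' := fun u v => by simp [add_mul, Finset.sum_add_distrib]
      map_smul' := fun r u => by simp [Finset.mul_sum, mul_assoc] }
    (by simp only [LinearMap.coe_mk, AddHom.coe_mk, key, toQuot_one, map_one])
    (fun u v => by simp only [LinearMap.coe_mk, AddHom.coe_mk, key, toQuot_mul, map_mul])

theorem character_apply (ω : ℂ) (hω : ω ^ n = s) (u : NComplex s n) :
    character ω hω u = ∑ p : Fin n, (u.coord p : ℂ) * ω ^ (p : ℕ) := rfl

theorem continuous_character (ω : ℂ) (hω : ω ^ n = s) :
    Continuous (character ω hω : NComplex s n → ℂ) :=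
  (character ω hω).toLinearMap.continuous_of_finiteDimensional

theorem conj_pow_eq {s : ℝ} {n : ℕ} {ω : ℂ} (hω : ω ^ n = s) : (starRingEnd ℂ ω) ^ n = s := by
  rw [← map_pow, hω, Complex.conj_ofReal]

theorem character_conj {ω : ℂ} (hω : ω ^ n = s) (u : NComplex s n) :
    character (starRingEnd ℂ ω) (conj_pow_eq hω) u = starRingEnd ℂ (character ω hω u) := by
  simp [character_apply]

theorem character_im_eq_zero {ω : ℂ} (hω : ω ^ n = s) (him : ω.im = 0) (u : NComplex s n) :
    (character ω hω u).im = 0 := by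
  rw [← Complex.conj_eq_iff_im, ← character_conj]
  congr 2
  exact Complex.conj_eq_iff_im.2 him

theorem character_ringInverse {ω : ℂ} (hω : ω ^ n = s) {u : NComplex s n} (hu : IsUnit u) :
    character ω hω (Ring.inverse u) = (character ω hω u)⁻¹ := by
  refine eq_inv_of_mul_eq_one_left ?_
  rw [← map_mul, Ring.inverse_mul_cancel u hu, map_one]

/-- The characters separate points, since `X ^ n - s` has `n` distinct complex roots: finitely many of
them embed the algebra into a power of `ℂ`. -/
theorem exists_injective_character (hs : s ≠ 0) :
    ∃ (r : Fin n → ℂ) (hr : ∀ m, r m ^ n = s),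
      Function.Injective (fun (u : NComplex s n) m => character (r m) (hr m) u) := by
  obtain ⟨ω₀, hω₀⟩ := IsAlgClosed.exists_pow_nat_eq (s : ℂ) (Nat.pos_of_ne_zero (NeZero.ne n))
  have hζ := Complex.isPrimitiveRoot_exp n (NeZero.ne n)
  set ζ := Complex.exp (2 * Real.pi * Complex.I / n)
  have hω₀0 : ω₀ ≠ 0 := by
    rintro rfl
    rw [zero_pow (NeZero.ne n)] at hω₀
    exact hs (by exact_mod_cast hω₀.symm)
  have hr : ∀ m : Fin n, (ω₀ * ζ ^ (m : ℕ)) ^ n = s := fun m => by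
    rw [mul_pow, hω₀, pow_right_comm, hζ.pow_eq_one, one_pow, mul_one]
  refine ⟨fun m => ω₀ * ζ ^ (m : ℕ), hr, fun u v huv => ?_⟩
  set P : Polynomial ℂ :=
    ∑ p : Fin n, Polynomial.C ((u - v).coord p : ℂ) * Polynomial.X ^ (p : ℕ) with hP
  have hcoeff : ∀ i : Fin n, P.coeff i = ((u - v).coord i : ℂ) := by
    intro i
    simp only [hP, Polynomial.finsetSum_coeff, Polynomial.coeff_C_mul, Polynomial.coeff_X_pow,
      Fin.val_inj]
    simp
  have hP0 : P = 0 := by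
    refine Polynomial.eq_zero_of_natDegree_lt_card_of_eval_eq_zero P
      (f := fun m : Fin n => ω₀ * ζ ^ (m : ℕ)) ?_ ?_ ?_
    · intro i j hij
      exact Fin.ext (hζ.pow_inj i.2 j.2 (mul_left_cancel₀ hω₀0 hij))
    · intro m
      have : character _ (hr m) (u - v) = 0 := by
        rw [map_sub, sub_eq_zero]
        exact congrFun huv m
      rw [character_apply] at this
      rw [hP, Polynomial.eval_finsetSum, ← this]
      simp
    · rw [Fintype.card_fin]
      refine lt_of_le_of_lt (Polynomial.natDegree_sum_le_of_forall_le (n := n - 1) _ _ fun p _ => ?_)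
        (Nat.sub_one_lt (NeZero.ne n))
      exact (Polynomial.natDegree_C_mul_X_pow_le _ _).trans (Nat.le_sub_one_of_lt p.2)
  rw [← sub_eq_zero]
  ext i
  have := hcoeff i
  rw [hP0, Polynomial.coeff_zero] at this
  exact_mod_cast this.symm

/-- The characters at the roots in the closed upper half plane already separate points, because
conjugate roots give conjugate characters. -/
theorem ext_character (hs : s ≠ 0) {u v : NComplex s n}
    (h : ∀ (ω : ℂ) (hω : ω ^ n = s), 0 ≤ ω.im → character ω hω u = character ω hω v) : u = v := by
  obtain ⟨r, hr, hinj⟩ := exists_injective_character (n := n) hs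
  refine hinj (funext fun m => ?_)
  rcases le_total 0 (r m).im with him | him
  · exact h _ _ him
  · refine (starRingEnd ℂ).injective ?_
    simp only [← character_conj]
    exact h _ _ (by simpa using him)

/-- Integrability can be tested on the characters. -/
theorem intervalIntegrable_of_character (hs : s ≠ 0) {h : ℝ → NComplex s n} {α β : ℝ}
    (hint : ∀ (ω : ℂ) (hω : ω ^ n = s), 0 ≤ ω.im →
      IntervalIntegrable (fun t => character ω hω (h t)) volume α β) :
    IntervalIntegrable h volume α β := by
  obtain ⟨r, hr, hinj⟩ := exists_injective_character (n := n) hs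
  let T : NComplex s n →ₗ[ℝ] (Fin n → ℂ) :=
    LinearMap.pi fun m => (character (r m) (hr m)).toLinearMap
  obtain ⟨S, hS⟩ := T.exists_leftInverse_of_injective (LinearMap.ker_eq_bot.2 hinj)
  have hT : IntervalIntegrable (fun t => T (h t)) volume α β := by
    have hm : ∀ m, IntervalIntegrable (fun t => character (r m) (hr m) (h t)) volume α β := by
      intro m
      rcases le_total 0 (r m).im with him | him
      · exact hint _ _ him
      · have h1 := hint _ (conj_pow_eq (hr m)) (by simpa using him)
        have h2 : IntervalIntegrable (fun t => Complex.conjCLE.toContinuousLinearMap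
            (character _ (conj_pow_eq (hr m)) (h t))) volume α β :=
          ⟨Complex.conjCLE.toContinuousLinearMap.integrable_comp h1.1,
            Complex.conjCLE.toContinuousLinearMap.integrable_comp h1.2⟩
        simpa only [character_conj (hr m), ContinuousLinearEquiv.coe_coe, Complex.conjCLE_apply,
          Complex.conj_conj] using h2
    exact ⟨Integrable.of_eval fun m => (hm m).1, Integrable.of_eval fun m => (hm m).2⟩
  have hST : h = fun t => S.toContinuousLinearMap (T (h t)) :=
    funext fun t => (LinearMap.congr_fun hS (h t)).symm
  rw [hST]
  exact ⟨S.toContinuousLinearMap.integrable_comp hT.1, S.toContinuousLinearMap.integrable_comp hT.2⟩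

theorem planeProj_eq_character {θ : ℝ} (hθ : Complex.exp (θ * Complex.I) ^ n = s)
    (u : NComplex s n) :
    planeProj θ u = character (Complex.exp (θ * Complex.I)) hθ u / (Real.sqrt (n / 2) : ℂ) := by
  have hpow : ∀ p : ℕ, Complex.exp (θ * Complex.I) ^ p =
      Complex.exp ((θ * p : ℝ) * Complex.I) := by
    intro p
    rw [← Complex.exp_nat_mul]
    congr 1
    push_cast
    ring
  rw [character_apply]
  apply Complex.ext
  · simp only [planeProj, cosComp, hpow, Complex.div_ofReal_re, Complex.re_sum,
      Complex.re_ofReal_mul, Complex.exp_ofReal_mul_I_re]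
  · simp only [planeProj, sinComp, hpow, Complex.div_ofReal_im, Complex.im_sum,
      Complex.im_ofReal_mul, Complex.exp_ofReal_mul_I_im]

theorem sum_pow_eq_of_pow_eq_one {n : ℕ} {ζ : ℂ} (hζ : ζ ^ n = 1) :
    ∑ p : Fin n, ζ ^ (p : ℕ) = if ζ = 1 then (n : ℂ) else 0 := by
  rw [Fin.sum_univ_eq_sum_range fun p => ζ ^ p]
  split_ifs with h
  · simp [h]
  · rw [geom_sum_eq h, hζ, sub_self, zero_div]

/-- Orthogonality: among the roots in the closed upper half plane, only `exp (i θ)` has a character that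
does not vanish on `ẽ`, and that value is `i`. -/
theorem character_eTilde (hs : s ^ 2 = 1) {θ : ℝ} (hθ : θ ∈ Ioo 0 Real.pi)
    (he : Complex.exp (θ * Complex.I) ^ n = s) {ω : ℂ} (hω : ω ^ n = s) (him : 0 ≤ ω.im) :
    character ω hω (eTilde θ : NComplex s n) =
      if ω = Complex.exp (θ * Complex.I) then Complex.I else 0 := by
  have hn : (n : ℂ) ≠ 0 := Nat.cast_ne_zero.2 (NeZero.ne n)
  set e := Complex.exp (θ * Complex.I) with hedef
  have he0 : e ≠ 0 := Complex.exp_ne_zero _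
  have hsC : (s : ℂ) ^ 2 = 1 := by exact_mod_cast hs
  have hs0 : (s : ℂ) ≠ 0 := fun h0 => by simp [h0] at hsC
  have hterm : ∀ p : ℕ, ((2 / n * Real.sin (θ * p) : ℝ) : ℂ) * ω ^ p =
      -Complex.I / n * ((e * ω) ^ p - (e⁻¹ * ω) ^ p) := by
    intro p
    have h1 : e ^ p = Complex.exp ((θ * p : ℂ) * Complex.I) := by
      rw [hedef, ← Complex.exp_nat_mul]; congr 1; ring
    have h2 : (e⁻¹) ^ p = Complex.exp (-(θ * p : ℂ) * Complex.I) := by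
      rw [hedef, ← Complex.exp_neg, ← Complex.exp_nat_mul]; congr 1; ring
    rw [mul_pow, mul_pow, h1, h2]
    push_cast
    rw [Complex.sin]
    field_simp
    ring
  have h1 : (e * ω) ^ n = 1 := by rw [mul_pow, he, hω, ← sq, hsC]
  have h2 : (e⁻¹ * ω) ^ n = 1 := by rw [mul_pow, inv_pow, he, hω, inv_mul_cancel₀ hs0]
  have hne : e * ω ≠ 1 := by
    intro h
    have hωe : ω = Complex.exp ((-θ : ℝ) * Complex.I) := by
      rw [eq_inv_of_mul_eq_one_right h, hedef, ← Complex.exp_neg]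
      push_cast
      ring_nf
    rw [hωe, Complex.exp_ofReal_mul_I_im, Real.sin_neg] at him
    linarith [Real.sin_pos_of_mem_Ioo hθ]
  rw [character_apply]
  simp only [eTilde, coord_mk, hterm]
  rw [← Finset.mul_sum, Finset.sum_sub_distrib, sum_pow_eq_of_pow_eq_one h1,
    sum_pow_eq_of_pow_eq_one h2, if_neg hne]
  have hiff : e⁻¹ * ω = 1 ↔ ω = e := by rw [inv_mul_eq_one₀ he0, eq_comm]
  simp only [hiff]
  split_ifs
  · field_simp
    ring
  · simp

end Character

end NComplex

/-! ### Piecewise `C¹` loops -/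

section PiecewiseC1

variable {E : Type*} [NormedAddCommGroup E] [NormedSpace ℝ E] {x y : E} {γ : Path x y}

theorem exists_mem_Ioo_of_notMem_range {m : ℕ} {τ : ℕ → ℝ} {t : ℝ}
    (ht : t ∈ Ioo (τ 0) (τ m)) (hτ : t ∉ range τ) : ∃ i < m, t ∈ Ioo (τ i) (τ (i + 1)) := by
  induction m with
  | zero => exact absurd (ht.1.trans ht.2) (lt_irrefl _)
  | succ m ih =>
    rcases lt_trichotomy t (τ m) with h | h | h
    · obtain ⟨i, hi, hmem⟩ := ih ⟨ht.1, h⟩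
      exact ⟨i, hi.trans (Nat.lt_succ_self m), hmem⟩
    · exact absurd ⟨m, h.symm⟩ hτ
    · exact ⟨m, Nat.lt_succ_self m, h, ht.2⟩

theorem PiecewiseC1.exists_countable_hasDerivAt (h : PiecewiseC1 γ) :
    ∃ S : Set ℝ, S.Countable ∧ ∀ t ∈ Ioo (0 : ℝ) 1 \ S,
      HasDerivAt γ.extend (derivWithin γ.extend I t) t := by
  obtain ⟨m, τ, -, h0, h1, hC⟩ := h
  refine ⟨range τ, countable_range τ, fun t ht => ?_⟩
  obtain ⟨i, hi, hti⟩ := exists_mem_Ioo_of_notMem_range (m := m) (τ := τ)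
    (by rw [h0, h1]; exact ht.1) ht.2
  rw [derivWithin_of_mem_nhds (Icc_mem_nhds ht.1.1 ht.1.2)]
  exact (((hC i hi).differentiableOn one_ne_zero).differentiableAt
    (Icc_mem_nhds hti.1 hti.2)).hasDerivAt

theorem PiecewiseC1.intervalIntegrable_derivWithin (h : PiecewiseC1 γ) :
    IntervalIntegrable (derivWithin γ.extend I) volume 0 1 := by
  obtain ⟨m, τ, hmono, h0, h1, hC⟩ := h
  rw [← h0, ← h1]
  refine IntervalIntegrable.trans_iterate fun i hi => ?_
  rcases (hmono (Nat.le_succ i)).eq_or_lt with heq | hlt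
  · rw [← Nat.succ_eq_add_one, ← heq]
  have hcont := (hC i hi).continuousOn_derivWithin (uniqueDiffOn_Icc hlt) le_rfl
  rw [← uIcc_of_le hlt.le] at hcont
  refine (hcont.intervalIntegrable).congr_ae ?_
  rw [uIoc_of_le hlt.le, ← restrict_Ioo_eq_restrict_Ioc, uIcc_of_le hlt.le]
  filter_upwards [ae_restrict_mem measurableSet_Ioo] with t ht
  have ht0 : 0 < t := lt_of_le_of_lt (h0 ▸ hmono (Nat.zero_le i)) ht.1
  have ht1 : t < 1 := lt_of_lt_of_le ht.2 (h1 ▸ hmono hi)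
  rw [derivWithin_of_mem_nhds (Icc_mem_nhds ht.1 ht.2), derivWithin_of_mem_nhds (Icc_mem_nhds ht0 ht1)]

theorem PiecewiseC1.hasVelocity (h : PiecewiseC1 γ) (L : E →L[ℝ] ℂ) :
    HasVelocity (fun t => L (γ.extend t)) (fun t => L (derivWithin γ.extend I t)) where
  continuousOn := (L.continuous.comp γ.continuous_extend).continuousOn
  intervalIntegrable := ⟨L.integrable_comp h.intervalIntegrable_derivWithin.1,
    L.integrable_comp h.intervalIntegrable_derivWithin.2⟩
  hasDerivAt := by
    obtain ⟨S, hS, hd⟩ := h.exists_countable_hasDerivAt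
    exact ⟨S, hS, fun t ht => L.hasFDerivAt.comp_hasDerivAt t (hd t ht)⟩

end PiecewiseC1

namespace NComplex

section Residue

variable {s : ℝ} {n : ℕ} [NeZero n]

/-! ### The residue formula for each character -/

theorem ExpandsAt.tendsto_character {f : NComplex s n → NComplex s n} {a : ℕ → NComplex s n}
    {c u : NComplex s n} (h : ExpandsAt f a c u) {ω : ℂ} (hω : ω ^ n = s) {ρ : ℂ} (hρ : ρ ≠ 0) :
    Tendsto (fun N : ℕ => ∑ l ∈ Finset.range N, character ω hω (a l) * ρ ^ l *
      (character ω hω u / ρ - character ω hω c / ρ) ^ l) atTop (𝓝 (character ω hω (f u))) := by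
  refine (((continuous_character ω hω).tendsto _).comp h).congr fun N => ?_
  simp only [Function.comp_apply, map_sum, map_mul, map_pow, map_sub]
  refine Finset.sum_congr rfl fun l _ => ?_
  rw [mul_assoc, ← mul_pow]
  congr 2
  field_simp

/-- A character maps a point of an open set strictly closer to the image of `c` than some other point of
that set. -/
theorem exists_norm_character_sub_lt {U : Set (NComplex s n)} (hU : IsOpen U) {u c : NComplex s n}
    (hu : u ∈ U) {ω : ℂ} (hω : ω ^ n = s) :
    ∃ w ∈ U, ‖character ω hω u - character ω hω c‖ < ‖character ω hω w - character ω hω c‖ := by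
  -- move `u` away from `c`, or in the direction of `1` when both have the same image
  obtain ⟨d, hd⟩ : ∃ d : NComplex s n, ∀ r : ℝ, 0 < r →
      ‖character ω hω u - character ω hω c‖ <
        ‖character ω hω (u + r • d) - character ω hω c‖ := by
    rcases eq_or_ne (character ω hω u) (character ω hω c) with h | h
    · refine ⟨1, fun r hr => ?_⟩
      simpa [h] using hr.ne'
    · refine ⟨u - c, fun r hr => ?_⟩
      have : character ω hω (u + r • (u - c)) - character ω hω c =
          ((1 + r : ℝ) : ℂ) * (character ω hω u - character ω hω c) := by
        rw [map_add, map_smul, map_sub, Complex.real_smul]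
        push_cast
        ring
      rw [this, norm_mul, Complex.norm_real, Real.norm_of_nonneg (by linarith)]
      have := norm_pos_iff.2 (sub_ne_zero.2 h)
      nlinarith
  have hc : Tendsto (fun r : ℝ => u + r • d) (𝓝[>] 0) (𝓝 u) := by
    have : Continuous fun r : ℝ => u + r • d := by fun_prop
    simpa using (this.tendsto 0).mono_left nhdsWithin_le_nhds
  obtain ⟨r, hrU, hr⟩ := ((hc.eventually (hU.eventually_mem hu)).and self_mem_nhdsWithin).exists
  exact ⟨_, hrU, hd r hr⟩

/-- The image of `f(u) du / (u - u₀)` under a character is the integrand of the plane residue formula for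
the projected loop. The scaling `ρ` is the one relating characters to plane projections. -/
theorem intervalIntegral_character_residueForm {f : NComplex s n → NComplex s n}
    {a : ℕ → NComplex s n} {c u₀ x : NComplex s n} {γ : Path x x} {U : Set (NComplex s n)}
    (hγ : PiecewiseC1 γ) (hU : IsOpen U) (hγU : range γ ⊆ U) (hf : ∀ u ∈ U, ExpandsAt f a c u)
    (hunit : ∀ t, IsUnit (γ t - u₀)) {ω : ℂ} (hω : ω ^ n = s) {ρ : ℝ} (hρ : ρ ≠ 0)
    (hin : IsInteriorPoint (character ω hω u₀ / ρ) ((fun u => character ω hω u / ρ) '' range γ) →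
      ExpandsAt f a c u₀ ∧
        WindsOnce (fun t => character ω hω (γ t) / ρ) (character ω hω u₀ / ρ)) :
    IntervalIntegrable (fun t => character ω hω (curveIntegralFun (residueForm f u₀) γ t))
      volume 0 1 ∧
    ∫ t in (0 : ℝ)..1, character ω hω (curveIntegralFun (residueForm f u₀) γ t) =
      2 * Real.pi * Complex.I *
        curveInt (character ω hω u₀ / ρ) ((fun u => character ω hω u / ρ) '' range γ) *
          character ω hω (f u₀) := by
  have hρC : (ρ : ℂ) ≠ 0 := Complex.ofReal_ne_zero.2 hρ
  let L : NComplex s n →L[ℝ] ℂ := ρ⁻¹ • (character ω hω).toLinearMap.toContinuousLinearMap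
  have hL : ∀ u, L u = character ω hω u / ρ := fun u => by
    change ρ⁻¹ • character ω hω u = _
    rw [Complex.real_smul, Complex.ofReal_inv, div_eq_inv_mul]
  have hvel := hγ.hasVelocity L
  simp only [hL] at hvel
  have himage : (fun t => character ω hω (γ.extend t) / ρ) '' Icc 0 1 =
      (fun u => character ω hω u / ρ) '' range γ := by
    ext w
    constructor
    · rintro ⟨t, ht, rfl⟩
      exact ⟨γ.extend t, ⟨⟨t, ht⟩, (γ.extend_apply ht).symm⟩, rfl⟩
    · rintro ⟨_, ⟨t, rfl⟩, rfl⟩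
      exact ⟨t, t.2, by simp⟩
  have hmemU : ∀ t ∈ Icc (0 : ℝ) 1, γ.extend t ∈ U := fun t ht =>
    hγU ⟨⟨t, ht⟩, (γ.extend_apply ht).symm⟩
  have hunit' : ∀ t ∈ Icc (0 : ℝ) 1, IsUnit (γ.extend t - u₀) := fun t ht => by
    rw [γ.extend_apply ht]
    exact hunit _
  have hne : ∀ t ∈ Icc (0 : ℝ) 1, character ω hω (γ.extend t) - character ω hω u₀ ≠ 0 := by
    intro t ht
    rw [← map_sub]
    exact ((hunit' t ht).map (character ω hω)).ne_zero
  have hmain := hvel.residue_formula (Φ := fun t => character ω hω (f (γ.extend t)))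
    (M := character ω hω u₀ / ρ) (c := character ω hω c / ρ) (y := character ω hω (f u₀))
    (b := fun l => character ω hω (a l) * (ρ : ℂ) ^ l) (by simp) ?_
    (fun t ht => (hf _ (hmemU t ht)).tendsto_character hω hρC) ?_ ?_
  · rw [himage] at hmain
    have hcongr : ∀ t ∈ Icc (0 : ℝ) 1,
        character ω hω (f (γ.extend t)) *
            (character ω hω (γ.extend t) / ρ - character ω hω u₀ / ρ)⁻¹ *
            (character ω hω (derivWithin γ.extend I t) / ρ) =
          character ω hω (curveIntegralFun (residueForm f u₀) γ t) := by
      intro t ht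
      have := hne t ht
      rw [curveIntegralFun_def]
      change _ = character ω hω (f (γ.extend t) * Ring.inverse (γ.extend t - u₀) *
        derivWithin γ.extend I t)
      rw [map_mul, map_mul, character_ringInverse hω (hunit' t ht), map_sub]
      field_simp
    refine ⟨hmain.1.congr fun t ht => ?_, ?_⟩
    · rw [uIoc_of_le zero_le_one] at ht
      exact hcongr t (Ioc_subset_Icc_self ht)
    · rw [← hmain.2]
      refine intervalIntegral.integral_congr fun t ht => ?_
      rw [uIcc_of_le zero_le_one] at ht
      exact (hcongr t ht).symm
  · rintro ⟨t, ht, h⟩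
    rw [div_left_inj' hρC] at h
    exact hne t ht (sub_eq_zero.2 h)
  · intro t ht
    obtain ⟨w, hw, hlt⟩ := exists_norm_character_sub_lt hU (c := c) (hmemU t ht) hω
    refine ⟨character ω hω w / ρ, _, ?_, (hf w hw).tendsto_character hω hρC⟩
    rw [← sub_div, ← sub_div, norm_div, norm_div]
    exact div_lt_div_of_pos_right hlt (norm_pos_iff.2 hρC)
  · intro hi
    rw [himage] at hi
    obtain ⟨hu₀, φ, hφ, -, hangle, hφ1⟩ := hin hi
    refine ⟨hu₀.tendsto_character hω hρC, IccExtend zero_le_one φ,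
      (hφ.Icc_extend' (h := zero_le_one)).continuousOn, fun t ht => ?_, ?_⟩
    · rw [IccExtend_of_mem _ _ ht, γ.extend_apply ht]
      exact hangle ⟨t, ht⟩
    · rw [IccExtend_right, IccExtend_left]
      exact hφ1

/-- The residue formula for `X ^ n = s`, `s = ±1`, with the non-real roots of the upper half plane
enumerated as `exp (i θ_k)`. -/
theorem curveIntegral_residueForm (hs : s ^ 2 = 1) {K : Finset ℕ} {θ : ℕ → ℝ}
    (hθ : ∀ k ∈ K, θ k ∈ Ioo 0 Real.pi) (hinj : InjOn θ K)
    (hroot : ∀ k ∈ K, Complex.exp (θ k * Complex.I) ^ n = s)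
    (hall : ∀ ω : ℂ, ω ^ n = s → 0 < ω.im → ∃ k ∈ K, ω = Complex.exp (θ k * Complex.I))
    {f : NComplex s n → NComplex s n}
    {a : ℕ → NComplex s n} {c u₀ x : NComplex s n} {γ : Path x x} {U : Set (NComplex s n)}
    (hγ : PiecewiseC1 γ) (hU : IsOpen U) (hγU : range γ ⊆ U) (hf : ∀ u ∈ U, ExpandsAt f a c u)
    (hunit : ∀ t, IsUnit (γ t - u₀))
    (hin : ∀ k ∈ K, IsInteriorPoint (planeProj (θ k) u₀) (planeProj (θ k) '' range γ) →
      ExpandsAt f a c u₀ ∧ WindsOnce (fun t => planeProj (θ k) (γ t)) (planeProj (θ k) u₀)) :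
    CurveIntegrable (residueForm f u₀) γ ∧
    curveIntegral (residueForm f u₀) γ =
      (2 * Real.pi) • (f u₀ * ∑ k ∈ K,
        curveInt (planeProj (θ k) u₀) (planeProj (θ k) '' range γ) • eTilde (θ k)) := by
  have hs0 : s ≠ 0 := fun h0 => by simp [h0] at hs
  set S : NComplex s n := ∑ k ∈ K,
    curveInt (planeProj (θ k) u₀) (planeProj (θ k) '' range γ) • eTilde (θ k) with hS
  have hSω : ∀ (ω : ℂ) (hω : ω ^ n = s), 0 ≤ ω.im → character ω hω S = ∑ k ∈ K,
      (curveInt (planeProj (θ k) u₀) (planeProj (θ k) '' range γ) : ℂ) *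
        if ω = Complex.exp (θ k * Complex.I) then Complex.I else 0 := by
    intro ω hω him
    rw [hS, map_sum]
    refine Finset.sum_congr rfl fun k hk => ?_
    rw [map_smul, Complex.real_smul, character_eTilde hs (hθ k hk) (hroot k hk) hω him]
  have hρ : Real.sqrt (n / 2) ≠ 0 := by
    have : (0 : ℝ) < n := Nat.cast_pos.2 (Nat.pos_of_ne_zero (NeZero.ne n))
    positivity
  have key : ∀ (ω : ℂ) (hω : ω ^ n = s), 0 ≤ ω.im →
      IntervalIntegrable (fun t => character ω hω (curveIntegralFun (residueForm f u₀) γ t))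
        volume 0 1 ∧
      ∫ t in (0 : ℝ)..1, character ω hω (curveIntegralFun (residueForm f u₀) γ t) =
        2 * Real.pi * (character ω hω (f u₀) * character ω hω S) := by
    intro ω hω him
    rw [hSω ω hω him]
    rcases him.eq_or_lt with h0 | hpos
    · -- a real root: the projected loop lies in a line and encloses nothing
      have hreal := character_im_eq_zero hω h0.symm
      have hext : ¬ IsInteriorPoint (character ω hω u₀ / (1 : ℝ))
          ((fun u => character ω hω u / (1 : ℝ)) '' range γ) := by
        refine not_isInteriorPoint_of_im_eq_zero ?_ (by simp [hreal]) ?_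
        · rintro ⟨_, ⟨t, rfl⟩, h⟩
          have := ((hunit t).map (character ω hω)).ne_zero
          rw [map_sub] at this
          simp only [Complex.ofReal_one, div_one] at h
          exact this (sub_eq_zero.2 h)
        · rintro _ ⟨u, -, rfl⟩
          simp [hreal]
      have h := intervalIntegral_character_residueForm hγ hU hγU hf hunit hω one_ne_zero
        fun hi => absurd hi hext
      refine ⟨h.1, h.2.trans ?_⟩
      rw [curveInt, if_neg hext, Finset.sum_eq_zero]
      · simp
      · intro k hk
        rw [if_neg, mul_zero]
        rintro rfl
        rw [Complex.exp_ofReal_mul_I_im] at h0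
        exact (Real.sin_pos_of_mem_Ioo (hθ k hk)).ne h0
    · obtain ⟨k, hk, rfl⟩ := hall ω hω hpos
      have hproj : planeProj (θ k) = fun u : NComplex s n =>
          character _ hω u / (Real.sqrt (n / 2) : ℂ) := funext (planeProj_eq_character hω)
      have hink := hin k hk
      simp only [hproj] at hink
      have h := intervalIntegral_character_residueForm hγ hU hγU hf hunit hω hρ hink
      refine ⟨h.1, h.2.trans ?_⟩
      rw [Finset.sum_eq_single_of_mem k hk, if_pos rfl, hproj]
      · ring
      · intro j hj hjk
        rw [if_neg, mul_zero]
        intro heq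
        refine hjk (hinj hj hk ?_)
        have harg : ∀ i ∈ K, Complex.arg (Complex.exp (θ i * Complex.I)) = θ i := fun i hi => by
          rw [Complex.arg_exp_mul_I, toIocMod_eq_self]
          constructor <;> linarith [(hθ i hi).1, (hθ i hi).2, Real.pi_pos]
        rw [← harg j hj, ← harg k hk, heq]
  have hint : CurveIntegrable (residueForm f u₀) γ :=
    intervalIntegrable_of_character hs0 fun ω hω him => (key ω hω him).1
  refine ⟨hint, ext_character hs0 fun ω hω him => ?_⟩
  rw [curveIntegral_def]
  have hcomm := (character ω hω).toLinearMap.toContinuousLinearMap.intervalIntegral_comp_comm hint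
  refine hcomm.symm.trans ((key ω hω him).2.trans ?_)
  rw [map_smul, map_mul, Complex.real_smul]
  push_cast
  ring

end Residue

/-! ### The roots of `1` and of `-1` in the upper half plane -/

theorem eq_exp_arg_of_pow {ω : ℂ} {n : ℕ} [NeZero n] {s : ℝ} (hs : s ^ 2 = 1) (hω : ω ^ n = s) :
    ω = Complex.exp (Complex.arg ω * Complex.I) := by
  have hnorm : ‖ω‖ = 1 := by
    rw [← pow_eq_one_iff_of_nonneg (norm_nonneg ω) (NeZero.ne n), ← norm_pow, hω,
      Complex.norm_real, Real.norm_eq_abs, ← sq_eq_sq₀ (abs_nonneg s) zero_le_one, sq_abs, hs,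
      one_pow]
  conv_lhs => rw [← Complex.norm_mul_exp_arg_mul_I ω, hnorm, Complex.ofReal_one, one_mul]

theorem arg_mem_Ioo {ω : ℂ} (him : 0 < ω.im) : Complex.arg ω ∈ Ioo 0 Real.pi := by
  refine ⟨lt_of_le_of_ne (Complex.arg_nonneg_iff.2 him.le) fun h => ?_,
    Complex.arg_lt_pi_iff.2 (Or.inr him.ne')⟩
  exact him.ne' (Complex.arg_eq_zero_iff.1 h.symm).2

theorem exp_polarAngle_pow (n k : ℕ) [NeZero n] :
    Complex.exp (polarAngle n k * Complex.I) ^ n = (1 : ℝ) := by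
  have hn : (n : ℂ) ≠ 0 := Nat.cast_ne_zero.2 (NeZero.ne n)
  rw [← Complex.exp_nat_mul, Complex.ofReal_one, Complex.exp_eq_one_iff]
  refine ⟨k, ?_⟩
  rw [polarAngle]
  push_cast
  field_simp

theorem exp_planarAngle_pow (n k : ℕ) [NeZero n] :
    Complex.exp (planarAngle n k * Complex.I) ^ n = (-1 : ℝ) := by
  have hn : (n : ℂ) ≠ 0 := Nat.cast_ne_zero.2 (NeZero.ne n)
  have : (n : ℂ) * (planarAngle n k * Complex.I) =
      (k : ℤ) * (2 * Real.pi * Complex.I) - Real.pi * Complex.I := by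
    rw [planarAngle]
    push_cast
    field_simp
  rw [← Complex.exp_nat_mul, this, Complex.exp_sub, Complex.exp_int_mul_two_pi_mul_I,
    Complex.exp_pi_mul_I]
  norm_num

theorem polarAngle_mem_Ioo {n k : ℕ} [NeZero n] (hk : k ∈ Finset.Icc 1 ((n - 1) / 2)) :
    polarAngle n k ∈ Ioo 0 Real.pi := by
  rw [Finset.mem_Icc] at hk
  have hn : (0 : ℝ) < n := Nat.cast_pos.2 (Nat.pos_of_ne_zero (NeZero.ne n))
  have h1 : (1 : ℝ) ≤ k := by exact_mod_cast hk.1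
  have h2 : 2 * (k : ℝ) < n := by exact_mod_cast (show 2 * k < n by omega)
  have := Real.pi_pos
  rw [polarAngle]
  refine ⟨by positivity, ?_⟩
  rw [div_lt_iff₀ hn]
  nlinarith

theorem planarAngle_mem_Ioo {n k : ℕ} [NeZero n] (hk : k ∈ Finset.Icc 1 (n / 2)) :
    planarAngle n k ∈ Ioo 0 Real.pi := by
  rw [Finset.mem_Icc] at hk
  have hn : (0 : ℝ) < n := Nat.cast_pos.2 (Nat.pos_of_ne_zero (NeZero.ne n))
  have h1 : (1 : ℝ) ≤ k := by exact_mod_cast hk.1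
  have h2 : 2 * (k : ℝ) ≤ n := by exact_mod_cast (show 2 * k ≤ n by omega)
  have := Real.pi_pos
  rw [planarAngle]
  refine ⟨div_pos (mul_pos this (by linarith)) hn, ?_⟩
  rw [div_lt_iff₀ hn]
  nlinarith

theorem polarAngle_injective (n : ℕ) [NeZero n] : Function.Injective (polarAngle n) := by
  intro j k h
  have hn : (n : ℝ) ≠ 0 := Nat.cast_ne_zero.2 (NeZero.ne n)
  have := Real.pi_ne_zero
  simp only [polarAngle] at h
  field_simp at h
  exact_mod_cast h

theorem planarAngle_injective (n : ℕ) [NeZero n] : Function.Injective (planarAngle n) := by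
  intro j k h
  have hn : (n : ℝ) ≠ 0 := Nat.cast_ne_zero.2 (NeZero.ne n)
  have := Real.pi_ne_zero
  simp only [planarAngle] at h
  field_simp at h
  have : (j : ℝ) = k := by linarith
  exact_mod_cast this

theorem exists_eq_exp_polarAngle {n : ℕ} [NeZero n] {ω : ℂ} (hω : ω ^ n = (1 : ℝ))
    (him : 0 < ω.im) :
    ∃ k ∈ Finset.Icc 1 ((n - 1) / 2), ω = Complex.exp (polarAngle n k * Complex.I) := by
  have hn : (0 : ℝ) < n := Nat.cast_pos.2 (Nat.pos_of_ne_zero (NeZero.ne n))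
  have hexp := eq_exp_arg_of_pow (one_pow 2) hω
  obtain ⟨h0, hπ⟩ := arg_mem_Ioo him
  set α := Complex.arg ω
  rw [hexp, ← Complex.exp_nat_mul, Complex.ofReal_one, Complex.exp_eq_one_iff] at hω
  obtain ⟨k, hk⟩ := hω
  have hkα : (n : ℝ) * α = k * (2 * Real.pi) := by
    have := congrArg Complex.im hk
    simpa using this
  have hk0 : 0 < k := by
    have : (0 : ℝ) < k := by
      by_contra! hle
      nlinarith [mul_pos hn h0, Real.pi_pos]
    exact_mod_cast this
  lift k to ℕ using hk0.le
  rw [Int.cast_natCast] at hkα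
  have hkn : 2 * k < n := by
    have : 2 * (k : ℝ) < n := by
      by_contra! hle
      nlinarith [mul_lt_mul_of_pos_left hπ hn, Real.pi_pos]
    exact_mod_cast this
  refine ⟨k, Finset.mem_Icc.2 ⟨by omega, by omega⟩, ?_⟩
  have hα : α = polarAngle n k := by
    rw [polarAngle, eq_div_iff hn.ne']
    linarith
  rw [← hα]
  exact hexp

theorem exists_eq_exp_planarAngle {n : ℕ} [NeZero n] {ω : ℂ} (hω : ω ^ n = (-1 : ℝ))
    (him : 0 < ω.im) :
    ∃ k ∈ Finset.Icc 1 (n / 2), ω = Complex.exp (planarAngle n k * Complex.I) := by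
  have hn : (0 : ℝ) < n := Nat.cast_pos.2 (Nat.pos_of_ne_zero (NeZero.ne n))
  have hexp := eq_exp_arg_of_pow (by norm_num) hω
  obtain ⟨h0, hπ⟩ := arg_mem_Ioo him
  set α := Complex.arg ω
  rw [hexp, ← Complex.exp_nat_mul, Complex.ofReal_neg, Complex.ofReal_one, ← Complex.exp_pi_mul_I,
    Complex.exp_eq_exp_iff_exists_int] at hω
  obtain ⟨k, hk⟩ := hω
  have hkα : (n : ℝ) * α = Real.pi + k * (2 * Real.pi) := by
    have := congrArg Complex.im hk
    simpa using this
  have hk0 : 0 ≤ k := by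
    have : (-1 : ℝ) < k := by
      by_contra! hle
      nlinarith [mul_pos hn h0, Real.pi_pos]
    have : -1 < k := by exact_mod_cast this
    omega
  lift k to ℕ using hk0
  rw [Int.cast_natCast] at hkα
  have hkn : 2 * k + 1 < n := by
    have : 2 * (k : ℝ) + 1 < n := by
      by_contra! hle
      nlinarith [mul_lt_mul_of_pos_left hπ hn, Real.pi_pos]
    exact_mod_cast this
  refine ⟨k + 1, Finset.mem_Icc.2 ⟨by omega, by omega⟩, ?_⟩
  have hα : α = planarAngle n (k + 1) := by
    rw [planarAngle, eq_div_iff hn.ne']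
    push_cast
    linarith
  rw [← hα]
  exact hexp

end NComplex

end

/-- The residue formula for polar and for planar `n`-complex numbers: if `f` is given by a power
series near the closed loop `γ`, and `u - u₀` is invertible along `γ`, then
`∮ f(u) du / (u - u₀) = 2π f(u₀) ∑_k ẽ_k int(u₀_k, Γ_k)`, where `u₀_k`, `Γ_k` are the projections of
`u₀` and of the loop on the `k`-th plane. A plane loop `Γ_k` that encloses `u₀_k` is to go round it
once, counterclockwise; and if some `Γ_k` encloses `u₀_k` then the series is to give `f` at `u₀`. -/
theorem mainTheorem3 :
    (∀ (n : ℕ) [NeZero n] (f : PolarComplex n → PolarComplex n)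
      (a : ℕ → PolarComplex n) (c u₀ x : PolarComplex n) (γ : Path x x) (U : Set (PolarComplex n)),
      PiecewiseC1 γ →
      IsOpen U → range γ ⊆ U → (∀ u ∈ U, NComplex.ExpandsAt f a c u) →
      (∀ t, IsUnit (γ t - u₀)) →
      (∀ k ∈ Finset.Icc 1 ((n - 1) / 2),
        IsInteriorPoint (NComplex.planeProj (NComplex.polarAngle n k) u₀)
          (NComplex.planeProj (NComplex.polarAngle n k) '' range γ) →
        NComplex.ExpandsAt f a c u₀ ∧
        WindsOnce (fun t => NComplex.planeProj (NComplex.polarAngle n k) (γ t))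
          (NComplex.planeProj (NComplex.polarAngle n k) u₀)) →
      CurveIntegrable (NComplex.residueForm f u₀) γ ∧
      curveIntegral (NComplex.residueForm f u₀) γ =
        (2 * Real.pi) • (f u₀ * ∑ k ∈ Finset.Icc 1 ((n - 1) / 2),
          curveInt (NComplex.planeProj (NComplex.polarAngle n k) u₀)
            (NComplex.planeProj (NComplex.polarAngle n k) '' range γ) •
              NComplex.eTilde (NComplex.polarAngle n k))) ∧
    (∀ (n : ℕ) [NeZero n], Even n → ∀ (f : PlanarComplex n → PlanarComplex n)
      (a : ℕ → PlanarComplex n) (c u₀ x : PlanarComplex n) (γ : Path x x)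
      (U : Set (PlanarComplex n)),
      PiecewiseC1 γ →
      IsOpen U → range γ ⊆ U → (∀ u ∈ U, NComplex.ExpandsAt f a c u) →
      (∀ t, IsUnit (γ t - u₀)) →
      (∀ k ∈ Finset.Icc 1 (n / 2),
        IsInteriorPoint (NComplex.planeProj (NComplex.planarAngle n k) u₀)
          (NComplex.planeProj (NComplex.planarAngle n k) '' range γ) →
        NComplex.ExpandsAt f a c u₀ ∧
        WindsOnce (fun t => NComplex.planeProj (NComplex.planarAngle n k) (γ t))
          (NComplex.planeProj (NComplex.planarAngle n k) u₀)) →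
      CurveIntegrable (NComplex.residueForm f u₀) γ ∧
      curveIntegral (NComplex.residueForm f u₀) γ =
        (2 * Real.pi) • (f u₀ * ∑ k ∈ Finset.Icc 1 (n / 2),
          curveInt (NComplex.planeProj (NComplex.planarAngle n k) u₀)
            (NComplex.planeProj (NComplex.planarAngle n k) '' range γ) •
              NComplex.eTilde (NComplex.planarAngle n k))) := by
  constructor
  · intro n _ f a c u₀ x γ U hγ hU hγU hf hunit hin
    exact NComplex.curveIntegral_residueForm (by norm_num)
      (fun k hk => NComplex.polarAngle_mem_Ioo hk) (NComplex.polarAngle_injective n).injOn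
      (fun k _ => NComplex.exp_polarAngle_pow n k)
      (fun ω hω him => NComplex.exists_eq_exp_polarAngle hω him) hγ hU hγU hf hunit hin
  · intro n _ _ f a c u₀ x γ U hγ hU hγU hf hunit hin
    exact NComplex.curveIntegral_residueForm (by norm_num)
      (fun k hk => NComplex.planarAngle_mem_Ioo hk) (NComplex.planarAngle_injective n).injOn
      (fun k _ => NComplex.exp_planarAngle_pow n k)
      (fun ω hω him => NComplex.exists_eq_exp_planarAngle hω him) hγ hU hγU hf hunit hin
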